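/- A digraph here has no loops or parallel edges. A dimaze $(D,B_0)$ is a digraph $D$ with a set $B_0$ of sinks of $D$, called exits. A set $A\subseteq V(D)$ is linkable if there is a set of pairwise vertex-disjoint finite directed paths in $D$ (possibly trivial), each ending in $B_0$, whose set of initial vertices is exactly $A$. Let $M_L(D,B_0)$ be the pair consisting of $V(D)$ and the family of linkable sets. Matroids may be infinite, given by their independent sets (axioms (I1), (I2), (I3), (IM) of Bruhn, Diestel, Kriesell, Pendavingh and Wollan); $M^*$ denotes the dual, whose bases are the complements of the bases of $M$. A strict gammoid is a matroid isomorphic to $M_L(D,B_0)$ for some dimaze $(D,B_0)$ for which this is a matroid; a gammoid is a matroid isomorphic to a restriction of a strict gammoid. Let $T$ be a rooted tree in which every vertex has infinitely many children. Let $B_0$ consist of the vertices at even distance from the root (so the root is in $B_0$), and direct every edge of $T$ towards its end in $B_0$. Then $M_L(T,B_0)$ is a matroid, hence a strict gammoid, and its dual $M_L(T,B_0)^*$ is not a gammoid. Consequently, the class of (infinite) gammoids is not closed under duality. -/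

import Mathlib

universe u v

/-- A dimaze: a loopless digraph with vertex set `V` together with a set of sinks, the exits. -/
structure Dimaze (V : Type u) where
  digraph : Digraph V
  exits : Set V
  loopless : ∀ v, ¬ digraph.Adj v v
  sink : ∀ b ∈ exits, ∀ v, ¬ digraph.Adj b v

/-- A list of vertices is a (finite, directed, possibly trivial) path of the digraph. -/
def Digraph.IsDiPath {V : Type u} (D : Digraph V) (p : List V) : Prop :=
  p ≠ [] ∧ p.Nodup ∧ p.IsChain D.Adj

namespace Dimaze

/-- A linkage: a set of pairwise vertex-disjoint paths, each ending in an exit. -/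
def IsLinkage {V : Type u} (D : Dimaze V) (P : Set (List V)) : Prop :=
  (∀ p ∈ P, D.digraph.IsDiPath p ∧ ∃ b ∈ D.exits, p.getLast? = some b) ∧
    P.Pairwise List.Disjoint

/-- `A` is linkable: it is the set of initial vertices of some linkage. -/
def Linkable {V : Type u} (D : Dimaze V) (A : Set V) : Prop :=
  ∃ P : Set (List V), D.IsLinkage P ∧ {a | ∃ p ∈ P, p.head? = some a} = A

/-- The pair consisting of the vertex set and the linkable sets of `D` is the matroid `M`
(given by its ground set and its independent sets). -/
def Defines {V : Type u} (D : Dimaze V) (M : Matroid V) : Prop :=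
  M.E = Set.univ ∧ ∀ I : Set V, M.Indep I ↔ D.Linkable I

end Dimaze

namespace Matroid

/-- Two matroids, possibly living on different types, are isomorphic. -/
def Isomorphic {α : Type u} {β : Type v} (M : Matroid α) (N : Matroid β) : Prop :=
  ∃ e : M.E ≃ N.E, ∀ I : Set M.E,
    M.Indep (Subtype.val '' I) ↔ N.Indep (Subtype.val '' (e '' I))

/-- A strict gammoid: a matroid isomorphic to the one defined by some dimaze.
The universe `v` is that of the dimaze. -/
def IsStrictGammoid {α : Type u} (M : Matroid α) : Prop :=
  ∃ (W : Type v) (D : Dimaze W) (N : Matroid W), D.Defines N ∧ M.Isomorphic N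

/-- A gammoid: a restriction of a strict gammoid (up to isomorphism, since the strict gammoid may
need further elements outside the type `α`). -/
def IsGammoid {α : Type u} (M : Matroid α) : Prop :=
  ∃ (β : Type v) (N : Matroid β) (X : Set β),
    IsStrictGammoid.{v, v} N ∧ X ⊆ N.E ∧ M.Isomorphic (N ↾ X)

end Matroid

/-- The dimaze of a rooted tree: the exits are the vertices on even levels (in particular the
root), and every edge of the tree is directed towards its end on an even level. -/
def alternatingTreeDimaze {V : Type u} (T : SimpleGraph V) (hT : T.IsTree) (r : V) :
    Dimaze V where
  digraph := ⟨fun v w => T.Adj v w ∧ Even (T.dist r w)⟩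
  exits := {v | Even (T.dist r v)}
  loopless := fun v h => T.irrefl h.1
  sink := by
    rintro b hb v ⟨hadj, hv⟩
    have hb' : Even (T.dist r b) := hb
    rcases hT.dist_eq_dist_add_one_of_adj r hadj with h | h
    · rw [h] at hb'
      exact (Nat.even_add_one.mp hb') hv
    · rw [h] at hv
      exact (Nat.even_add_one.mp hv) hb'

/-!
In the alternating dimaze of a tree every path has at most one edge, so a set is linkable if and
only if it has a matching that sends its even vertices (the exits) to themselves and its odd
vertices to neighbours (`linkable_iff_matchable`). For such transversal systems the exchange axiom
follows by shifting along an alternating path (`Matchable.exists_insert`). The existence of maximal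
independent sets uses that the bipartite graph is a rooted forest
(`BipForest.existsMaximalSubsetProperty_matchable`): a transfinite analysis determines which
vertices are "needy", i.e. would have to be matched to their parents if everything below were to be
matched, and a matching that respects it leaves no room for infinite alternating paths.

A set is independent in the dual if some base avoids it, and a matching of a base covers all exits.
So each exit in such a set has a private neighbour outside the set. If the dual were a gammoid, its
independent sets would be the linkable sets of some dimaze. The odd vertices form an independent
set, so fix a linkage of it. Starting from the root, one constructs a ray `e₀, o₀, e₁, o₁, …` going
away from the root and paths starting in the `eᵢ` such that exchanging the paths of the odd vertices
`oᵢ` of the ray for these new paths keeps the paths disjoint (`RayStage.exists_next`). A path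
starting in a child of the last odd vertex is followed until it meets the current linkage. Because
there are infinitely many such children, for some of them this leads to the path of one of their own
children. Every path is changed at most once, so in the limit the set of odd vertices with all `oᵢ`
exchanged for the `eᵢ` is linkable. It is however dependent
(`Dimaze.Defines.not_dual_indep_of_ray`): a base avoiding it would have to match each `oᵢ` to
`eᵢ`, and matching `oᵢ` to `eᵢ₊₁` instead makes room for `e₀`.

The matroid of the dimaze is itself a gammoid, so a single tree with infinite branching shows that
gammoids are not closed under duality. The tree of finite sequences of natural numbers exists in
every universe, and its matroid can be moved between universes.
-/

open Set

/-! ### Transversal systems -/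

/-- `A` is matchable into `R` along the bipartite graph `Edge`: some injection on `A` sends every
element of `A` to one of its neighbours. -/
def Matchable {L : Type u} {R : Type v} (Edge : L → R → Prop) (A : Set L) : Prop :=
  ∃ m : L → R, InjOn m A ∧ ∀ a ∈ A, Edge a (m a)

namespace Matchable

variable {L : Type u} {R : Type v} {Edge : L → R → Prop}

lemma mono {A B : Set L} (hB : Matchable Edge B) (h : A ⊆ B) : Matchable Edge A := by
  obtain ⟨m, hm, hE⟩ := hB
  exact ⟨m, hm.mono h, fun a ha => hE a (h ha)⟩

lemma insert_of_free {A : Set L} {m : L → R} (hm : InjOn m A) (hE : ∀ a ∈ A, Edge a (m a))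
    {x : L} {r : R} (hxr : Edge x r) (hr : ∀ a ∈ A, m a ≠ r) : Matchable Edge (insert x A) := by
  classical
  by_cases hx : x ∈ A
  · rw [insert_eq_of_mem hx]
    exact ⟨m, hm, hE⟩
  · refine ⟨Function.update m x r, ?_, ?_⟩
    · rintro a (rfl | ha) b (rfl | hb) hab
      · rfl
      · have hne : b ≠ a := by rintro rfl; exact hx hb
        simp only [Function.update_self, Function.update_of_ne hne] at hab
        exact (hr b hb hab.symm).elim
      · have hne : a ≠ b := by rintro rfl; exact hx ha
        simp only [Function.update_self, Function.update_of_ne hne] at hab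
        exact (hr a ha hab).elim
      · have hne : a ≠ x := by rintro rfl; exact hx ha
        have hne' : b ≠ x := by rintro rfl; exact hx hb
        simp only [Function.update_of_ne hne', Function.update_of_ne hne] at hab
        exact hm ha hb hab
    · rintro a (rfl | ha)
      · simpa using hxr
      · have hne : a ≠ x := by rintro rfl; exact hx ha
        simpa [Function.update_of_ne hne] using hE a ha

/-- The elements met by the path that starts in `x` and follows alternately an edge of `m` and,
backwards, an edge of the matching `n` of `B`, as long as it stays in `I`. -/
inductive AltReach (m n : L → R) (I B : Set L) (x : L) : L → Prop
  | base : AltReach m n I B x x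
  | step {y b : L} : AltReach m n I B x y → y ∈ insert x I → b ∈ B → n b = m y →
      AltReach m n I B x b

/-- The exchange axiom for transversal systems, finite or not. Follow the path alternating between
a matching of `I + x` and one of `B`, starting at `x`. If it leaves `I`, then shifting along the
finite path so far adds its last vertex, an element of `B`, to `I`. If it stays in `I` for ever or
stops at a vertex of `R` outside the matching of `B`, then shifting along the whole path adds `x`
to `B`, which is impossible. -/
lemma exists_insert {I B : Set L} (hI : Matchable Edge I) (hImax : ¬ Maximal (Matchable Edge) I)
    (hB : Maximal (Matchable Edge) B) : ∃ x ∈ B \ I, Matchable Edge (insert x I) := by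
  classical
  obtain ⟨x, hxI, hx⟩ : ∃ x ∉ I, Matchable Edge (insert x I) := by
    by_contra! h
    refine hImax ⟨hI, fun K hK hIK k hk => ?_⟩
    by_contra hkI
    exact h k hkI (hK.mono (insert_subset hk hIK))
  by_cases hxB : x ∈ B
  · exact ⟨x, ⟨hxB, hxI⟩, hx⟩
  obtain ⟨m, hm, hmE⟩ := hx
  obtain ⟨n, hn, hnE⟩ := hB.prop
  by_cases hS : ∀ y, AltReach m n I B x y → y ∈ insert x I
  · exfalso
    refine hxB (hB.le_of_ge (y := insert x B) ?_ (subset_insert _ _) (mem_insert _ _))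
    refine ⟨fun y => if AltReach m n I B x y then m y else n y, ?_, ?_⟩
    · have hmem : ∀ y ∈ insert x B, ¬ AltReach m n I B x y → y ∈ B := by
        rintro y (rfl | hy) h
        · exact (h .base).elim
        · exact hy
      intro a ha b hb hab
      by_cases ha' : AltReach m n I B x a <;> by_cases hb' : AltReach m n I B x b <;>
        simp only [ha', hb', if_true, if_false] at hab
      · exact hm (hS a ha') (hS b hb') hab
      · exact (hb' (ha'.step (hS a ha') (hmem b hb hb') hab.symm)).elim
      · exact (ha' (hb'.step (hS b hb') (hmem a ha ha') hab)).elim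
      · exact hn (hmem a ha ha') (hmem b hb hb') hab
    · intro a ha
      by_cases ha' : AltReach m n I B x a
      · simpa [ha'] using hmE a (hS a ha')
      · simp only [ha', if_false]
        rcases ha with rfl | ha
        · exact (ha' .base).elim
        · exact hnE a ha
  · push Not at hS
    obtain ⟨z, hz, hzI⟩ := hS
    -- Shifting along the path up to `y` frees the vertex `m y`.
    have key : ∀ y, AltReach m n I B x y → y ∈ insert x I → ∃ k : L → R, InjOn k I ∧
        (∀ i ∈ I, Edge i (k i)) ∧ (∀ i ∈ I, k i = m i ∨ (i ∈ B ∧ k i = n i)) ∧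
        ∀ i ∈ I, k i ≠ m y := by
      intro y hy
      induction hy with
      | base =>
        intro _
        refine ⟨m, hm.mono (subset_insert _ _), fun i hi => hmE i (.inr hi), fun i _ => .inl rfl,
          fun i hi h => ?_⟩
        exact hxI (hm (.inr hi) (.inl rfl) h ▸ hi)
      | @step y b hy hyI hbB hnb ih =>
        intro hbI
        have hbx : b ≠ x := by rintro rfl; exact hxB hbB
        replace hbI : b ∈ I := hbI.resolve_left hbx
        obtain ⟨k, hk, hkE, hkmn, hky⟩ := ih hyI
        have hkb : k b = m b := by
          rcases hkmn b hbI with h | h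
          · exact h
          · exact (hky b hbI (h.2.trans hnb)).elim
        refine ⟨Function.update k b (n b), ?_, ?_, ?_, ?_⟩
        · intro i hi j hj hij
          by_cases hib : i = b <;> by_cases hjb : j = b
          · rw [hib, hjb]
          · subst hib
            simp only [Function.update_self, Function.update_of_ne hjb] at hij
            exact (hky j hj (hij.symm.trans hnb)).elim
          · subst hjb
            simp only [Function.update_self, Function.update_of_ne hib] at hij
            exact (hky i hi (hij.trans hnb)).elim
          · simp only [Function.update_of_ne hib, Function.update_of_ne hjb] at hij
            exact hk hi hj hij
        · intro i hi
          by_cases hib : i = b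
          · subst hib; simpa using hnE i hbB
          · simpa [Function.update_of_ne hib] using hkE i hi
        · intro i hi
          by_cases hib : i = b
          · subst hib; exact .inr ⟨hbB, by simp⟩
          · simpa [Function.update_of_ne hib] using hkmn i hi
        · intro i hi h
          by_cases hib : i = b
          · subst hib
            simp only [Function.update_self] at h
            exact hky i hi (hkb.trans (h.symm.trans hnb))
          · simp only [Function.update_of_ne hib] at h
            exact hib (hk hi hbI (h.trans hkb.symm))
    cases hz with
    | base => exact (hzI (mem_insert _ _)).elim
    | step hy hyI hzB hnz =>
      obtain ⟨k, hk, hkE, -, hky⟩ := key _ hy hyI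
      exact ⟨z, ⟨hzB, fun h => hzI (.inr h)⟩, insert_of_free hk hkE (hnz ▸ hnE z hzB) hky⟩

end Matchable

/-! ### Maximal matchable sets in rooted forests -/

/-- A bipartite graph between `L` and `R` that is a rooted forest: `up l` is the parent of `l`, and
`dn r` is the parent of `r`, if there is one. So `dn r = some l` says that `r` is a child of `l`.
Every vertex of `L` has a parent, and so all roots lie in `R`. -/
structure BipForest (L : Type u) (R : Type v) where
  /-- the parent of a vertex of `L` -/
  up : L → R
  /-- the parent of a vertex of `R` -/
  dn : R → Option L
  /-- the depth of a vertex of `L` -/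
  depth : L → ℕ
  depth_lt : ∀ l l', dn (up l) = some l' → depth l' < depth l

namespace BipForest

variable {L : Type u} {R : Type v} (F : BipForest L R)

/-- Adjacency in the forest. -/
def Edge (l : L) (r : R) : Prop := F.up l = r ∨ F.dn r = some l

lemma up_ne_of_dn {l : L} {r : R} (h : F.dn r = some l) : F.up l ≠ r := by
  rintro rfl
  exact lt_irrefl _ (F.depth_lt _ _ h)

/-- `F.NeedyAt X a v`: the vertex `v` belongs to `X`, and each child `r` of `v` has a child `f r`
that is needy at a stage `g r` below `a`. -/
inductive NeedyAt (X : Set L) : Ordinal.{v} → L → Prop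
  | mk {a : Ordinal.{v}} {v : L} (f : R → L) (g : R → Ordinal.{v}) (hv : v ∈ X)
      (hf : ∀ r, F.dn r = some v → F.up (f r) = r) (hg : ∀ r, F.dn r = some v → g r < a)
      (h : ∀ r, F.dn r = some v → NeedyAt X (g r) (f r)) : NeedyAt X a v

/-- The needy vertices of `X`: if all of `X` were to be matched, they would have to be
matched to their parents. They form the least set containing every `v ∈ X` such that each child
of `v` has a child in the set. -/
def needy (X : Set L) : Set L := {v | ∃ a, F.NeedyAt X a v}

/-- The first stage at which a vertex is needy. -/
noncomputable def rank (X : Set L) (v : L) : Ordinal.{v} := sInf {a | F.NeedyAt X a v}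

variable {F} {X I : Set L}

lemma mem_of_mem_needy {v : L} (h : v ∈ F.needy X) : v ∈ X := by
  obtain ⟨a, h⟩ := h
  cases h
  assumption

lemma exists_rank_lt {v : L} (hv : v ∈ F.needy X) {r : R} (hr : F.dn r = some v) :
    ∃ w ∈ F.needy X, F.up w = r ∧ F.rank X w < F.rank X v := by
  have h : F.NeedyAt X (F.rank X v) v := csInf_mem (s := {a | F.NeedyAt X a v}) hv
  generalize F.rank X v = a at h
  cases h with
  | mk f g hv hf hg h =>
    have hle : F.rank X (f r) ≤ g r := by
      have hmem : g r ∈ {a | F.NeedyAt X a (f r)} := h r hr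
      exact csInf_le' hmem
    exact ⟨f r, ⟨_, h r hr⟩, hf r hr, hle.trans_lt (hg r hr)⟩

lemma mem_needy {v : L} (hv : v ∈ X)
    (h : ∀ r, F.dn r = some v → ∃ w ∈ F.needy X, F.up w = r) : v ∈ F.needy X := by
  classical
  have h' : ∀ r, ∃ w a, F.dn r = some v → F.up w = r ∧ F.NeedyAt X a w := by
    intro r
    by_cases hr : F.dn r = some v
    · obtain ⟨w, ⟨a, hw⟩, hwr⟩ := h r hr
      exact ⟨w, a, fun _ => ⟨hwr, hw⟩⟩
    · exact ⟨v, 0, fun h => (hr h).elim⟩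
  choose f g hfg using h'
  have hup := fun r hr => (hfg r hr).1
  have hg := fun r hr => (hfg r hr).2
  have hlt : ∀ r, g r < Order.succ (⨆ r, g r) := fun r =>
    Order.lt_succ_of_le (le_ciSup Ordinal.bddAbove_of_small r)
  exact ⟨_, .mk f g hv hup (fun r _ => hlt r) hg⟩

lemma exists_child_of_notMem_needy {v : L} (hv : v ∈ X) (h : v ∉ F.needy X) :
    ∃ r, F.dn r = some v ∧ ∀ w ∈ F.needy X, F.up w ≠ r := by
  by_contra! hc
  exact h (mem_needy hv hc)

lemma needy_mono (hIX : I ⊆ X) : F.needy I ⊆ F.needy X := by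
  have key : ∀ a : Ordinal.{v}, ∀ v ∈ F.needy I, F.rank I v = a → v ∈ F.needy X := by
    intro a
    induction a using WellFoundedLT.induction with
    | ind a ih =>
      rintro v hv rfl
      refine mem_needy (hIX (mem_of_mem_needy hv)) fun r hr => ?_
      obtain ⟨w, hw, hwr, hlt⟩ := exists_rank_lt hv hr
      exact ⟨w, ih _ hlt w hw rfl, hwr⟩
  exact fun v hv => key _ v hv rfl

lemma eq_up_of_mem_needy {A : Set L} {k : L → R} (hk : InjOn k A) (hE : ∀ a ∈ A, F.Edge a (k a))
    (hIA : I ⊆ A) {v : L} (hv : v ∈ F.needy I) : k v = F.up v := by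
  have key : ∀ a : Ordinal.{v}, ∀ v ∈ F.needy I, F.rank I v = a → k v = F.up v := by
    intro a
    induction a using WellFoundedLT.induction with
    | ind a ih =>
      rintro v hv rfl
      rcases hE v (hIA (mem_of_mem_needy hv)) with h | h
      · exact h.symm
      · obtain ⟨w, hw, hwr, hlt⟩ := exists_rank_lt hv h
        have hwk := ih _ hlt w hw rfl
        have : w = v := hk (hIA (mem_of_mem_needy hw)) (hIA (mem_of_mem_needy hv))
          (hwk.trans hwr)
        subst this
        exact (F.up_ne_of_dn h hwr).elim
  exact key _ v hv rfl

/-- Top-down allocation of parents to needy vertices of `X`. Each `r` is offered to its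
child `sel r`; but if its parent `u` lies in `I`, has not been granted its own parent and picks
`r`, then `r` goes to `u`. -/
def Granted (F : BipForest L R) (I X : Set L) (sel : R → L) (pick : L → R) (v : L) : Prop :=
  v ∈ F.needy X ∧ sel (F.up v) = v ∧ ∀ u, F.dn (F.up v) = some u → pick u = F.up v → u ∈ I →
    Granted F I X sel pick u
termination_by F.depth v
decreasing_by exact F.depth_lt _ _ ‹_›

lemma granted_iff {sel : R → L} {pick : L → R} {v : L} : Granted F I X sel pick v ↔
    v ∈ F.needy X ∧ sel (F.up v) = v ∧ ∀ u, F.dn (F.up v) = some u → pick u = F.up v → u ∈ I →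
      Granted F I X sel pick u := by
  rw [Granted]

/-- A choice function for the needy children of vertices of `R`: needy vertices of `I` come first,
and otherwise a vertex of least rank is chosen. -/
lemma exists_sel (F : BipForest L R) [Nonempty L] (I X : Set L) : ∃ sel : R → L,
    (∀ w ∈ F.needy I, sel (F.up w) ∈ F.needy I ∧ F.up (sel (F.up w)) = F.up w) ∧
    ∀ w ∈ F.needy X, (∀ w' ∈ F.needy I, F.up w' ≠ F.up w) → sel (F.up w) ∈ F.needy X ∧
      F.up (sel (F.up w)) = F.up w ∧ F.rank X (sel (F.up w)) ≤ F.rank X w := by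
  classical
  have : ∀ r, ∃ s, (∀ w ∈ F.needy I, F.up w = r → s ∈ F.needy I ∧ F.up s = r) ∧
      ∀ w ∈ F.needy X, F.up w = r → (∀ w' ∈ F.needy I, F.up w' ≠ r) → s ∈ F.needy X ∧
      F.up s = r ∧ F.rank X s ≤ F.rank X w := by
    intro r
    by_cases h : ∃ s ∈ F.needy I, F.up s = r
    · obtain ⟨s, hs, hsr⟩ := h
      exact ⟨s, fun w _ _ => ⟨hs, hsr⟩, fun w _ _ hn => (hn s hs hsr).elim⟩
    · push Not at h
      by_cases h' : ∃ s ∈ F.needy X, F.up s = r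
      · have hne : {s | s ∈ F.needy X ∧ F.up s = r}.Nonempty := h'
        have hmem := Function.argminOn_mem (F.rank X) _ hne
        refine ⟨Function.argminOn (F.rank X) _ hne, fun w hw hwr => (h w hw hwr).elim,
          fun w hw hwr _ => ⟨hmem.1, hmem.2, ?_⟩⟩
        exact Function.argminOn_le (F.rank X) _ (show w ∈ {s | s ∈ F.needy X ∧ F.up s = r} from
          ⟨hw, hwr⟩)
      · push Not at h'
        exact ⟨Classical.arbitrary L, fun w hw hwr => (h w hw hwr).elim,
          fun w hw hwr => (h' w hw hwr).elim⟩
  choose sel h1 h2 using this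
  exact ⟨sel, fun w hw => h1 _ w hw rfl, fun w hw hn => h2 _ w hw rfl hn⟩

lemma exists_pick (F : BipForest L R) [Nonempty R] (I X : Set L) : ∃ pick : L → R,
    (∀ v ∈ X, v ∉ F.needy X → F.dn (pick v) = some v ∧ ∀ w ∈ F.needy X, F.up w ≠ pick v) ∧
    ∀ v ∈ I, v ∈ F.needy X → v ∉ F.needy I →
      F.dn (pick v) = some v ∧ ∀ w ∈ F.needy I, F.up w ≠ pick v := by
  classical
  have : ∀ v, ∃ r, (v ∈ X → v ∉ F.needy X → F.dn r = some v ∧ ∀ w ∈ F.needy X, F.up w ≠ r) ∧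
    (v ∈ I → v ∈ F.needy X → v ∉ F.needy I →
      F.dn r = some v ∧ ∀ w ∈ F.needy I, F.up w ≠ r) := by
    intro v
    by_cases h : v ∈ X ∧ v ∉ F.needy X
    · obtain ⟨r, hr⟩ := exists_child_of_notMem_needy h.1 h.2
      exact ⟨r, fun _ _ => hr, fun _ h' => (h.2 h').elim⟩
    · by_cases h' : v ∈ I ∧ v ∉ F.needy I
      · obtain ⟨r, hr⟩ := exists_child_of_notMem_needy h'.1 h'.2
        exact ⟨r, fun a b => (h ⟨a, b⟩).elim, fun _ _ _ => hr⟩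
      · exact ⟨Classical.arbitrary R, fun a b => (h ⟨a, b⟩).elim, fun a _ b => (h' ⟨a, b⟩).elim⟩
  choose pick h1 h2 using this
  exact ⟨pick, h1, h2⟩

/-- In a rooted forest, a matchable subset `I` of `X` extends to a maximal matchable subset of `X`.
Needy vertices of `I` are matched to their parents; among the other needy vertices of `X`, each
vertex of `R` is given to one child of least rank, unless its parent lies in `I` and must use it.
All other vertices are matched downwards. As ranks decrease downwards and depths decrease
upwards, an alternating path that would allow a further vertex to be added has nowhere to go. -/
theorem existsMaximalSubsetProperty_matchable (F : BipForest L R) (X : Set L) :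
    Matroid.ExistsMaximalSubsetProperty (Matchable F.Edge) X := by
  classical
  intro I hI hIX
  rcases isEmpty_or_nonempty L with hL | hL
  · exact ⟨I, Subset.rfl, ⟨hI, hIX⟩, fun K _ _ x => (hL.false x).elim⟩
  have hR : Nonempty R := ⟨F.up (Classical.arbitrary L)⟩
  obtain ⟨sel, selI, selX⟩ := F.exists_sel I X
  obtain ⟨pick, pickX, pickI⟩ := F.exists_pick I X
  have hmono : F.needy I ⊆ F.needy X := needy_mono hIX
  have selI' : ∀ w ∈ F.needy I, sel (F.up w) = w := by
    intro w hw
    obtain ⟨m, hm, hmE⟩ := hI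
    obtain ⟨h1, h2⟩ := selI w hw
    refine hm (mem_of_mem_needy h1) (mem_of_mem_needy hw) ?_
    rw [eq_up_of_mem_needy hm hmE Subset.rfl h1, eq_up_of_mem_needy hm hmE Subset.rfl hw, h2]
  -- A vertex of `I` whose picked child has a needy child is itself needy.
  have pick_needy : ∀ u ∈ I, ∀ w ∈ F.needy X, pick u = F.up w → u ∈ F.needy X := by
    intro u hu w hw h
    by_contra hc
    exact (pickX u (hIX hu) hc).2 w hw h.symm
  have grantI : ∀ n : ℕ, ∀ v ∈ F.needy I, F.depth v = n → Granted F I X sel pick v := by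
    intro n
    induction n using Nat.strong_induction_on with
    | _ n ih =>
      rintro v hv rfl
      refine granted_iff.2 ⟨hmono hv, selI' v hv, fun u hu hpu huI => ?_⟩
      by_cases huN : u ∈ F.needy I
      · exact ih _ (F.depth_lt _ _ hu) u huN rfl
      · have := pickI u huI (pick_needy u huI v (hmono hv) hpu) huN
        exact (this.2 v hv hpu.symm).elim
  set G : L → Prop := Granted F I X sel pick with hG
  replace grantI : ∀ v ∈ F.needy I, G v := fun v hv => grantI _ v hv rfl
  have hGX : ∀ v, G v → v ∈ X := fun v hv => mem_of_mem_needy (granted_iff.1 hv).1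
  let J : Set L := {v | v ∈ X ∧ (G v ∨ v ∉ F.needy X ∨ v ∈ I)}
  have hIJ : I ⊆ J := fun v hv => ⟨hIX hv, .inr (.inr hv)⟩
  have hGJ : ∀ v, G v → v ∈ J := fun v hv => ⟨hGX v hv, .inl hv⟩
  have pick_dn : ∀ v ∈ J, ¬ G v → F.dn (pick v) = some v := by
    rintro v ⟨hvX, hv⟩ hGv
    by_cases hvN : v ∈ F.needy X
    · have hvI : v ∈ I := by tauto
      exact (pickI v hvI hvN fun h => hGv (grantI v h)).1
    · exact (pickX v hvX hvN).1
  have hne : ∀ v w, G v → w ∈ J → ¬ G w → F.up v ≠ pick w := by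
    intro v w hv hw hGw h
    obtain ⟨hvN, -, hvu⟩ := granted_iff.1 hv
    have hd := pick_dn w hw hGw
    by_cases hwN : w ∈ F.needy X
    · have hwI : w ∈ I := by
        rcases hw.2 with h | h | h
        exacts [(hGw h).elim, (h hwN).elim, h]
      exact hGw (hvu w (h ▸ hd) h.symm hwI)
    · exact (pickX w hw.1 hwN).2 v hvN h
  refine ⟨J, hIJ, ⟨⟨fun v => if G v then F.up v else pick v, ?_, ?_⟩, fun v hv => hv.1⟩, ?_⟩
  · intro v hv w hw hvw
    by_cases hGv : G v <;> by_cases hGw : G w <;> simp only [hGv, hGw, if_true, if_false] at hvw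
    · rw [← (granted_iff.1 hGv).2.1, hvw, (granted_iff.1 hGw).2.1]
    · exact (hne v w hGv hw hGw hvw).elim
    · exact (hne w v hGw hv hGv hvw.symm).elim
    · have h1 := pick_dn v hv hGv
      rw [hvw, pick_dn w hw hGw] at h1
      exact (Option.some.inj h1).symm
  · intro v hv
    by_cases hGv : G v
    · simp [hGv, Edge]
    · simp [hGv, Edge, pick_dn v hv hGv]
  · rintro K ⟨⟨k, hk, hkE⟩, hKX⟩ hJK z hzK
    have hIK : I ⊆ K := hIJ.trans hJK
    have forced : ∀ v ∈ F.needy I, k v = F.up v := fun v hv => eq_up_of_mem_needy hk hkE hIK hv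
    -- If a vertex `r` with a needy child is not kept for its parent, then it is used by a needy
    -- vertex of `I` or goes to a granted child of least rank.
    have offer : ∀ r u, F.dn r = some u → (pick u = r → u ∈ I → G u) → ∀ w ∈ F.needy X,
        F.up w = r → ∃ b, F.up b = r ∧ (b ∈ F.needy I ∨ G b ∧ F.rank X b ≤ F.rank X w) := by
      rintro _ u hu hpu w hw rfl
      by_cases hI : ∃ b ∈ F.needy I, F.up b = F.up w
      · obtain ⟨b, hb, hbr⟩ := hI
        exact ⟨b, hbr, .inl hb⟩
      · push Not at hI
        obtain ⟨h1, h2, h3⟩ := selX w hw hI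
        refine ⟨_, h2, .inr ⟨granted_iff.2 ⟨h1, by rw [h2], fun u' hu' hpu' hI' => ?_⟩, h3⟩⟩
        rw [h2] at hu' hpu'
        obtain rfl : u = u' := Option.some.inj (hu.symm.trans hu')
        exact hpu hpu' hI'
    have forcedG : ∀ a : Ordinal.{v}, ∀ b, G b → F.rank X b = a → k b = F.up b := by
      intro a
      induction a using WellFoundedLT.induction with
      | ind a ih =>
        rintro b hb rfl
        rcases hkE b (hJK (hGJ b hb)) with h | h
        · exact h.symm
        · obtain ⟨w, hw, hwr, hlt⟩ := exists_rank_lt (granted_iff.1 hb).1 h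
          obtain ⟨c, hcr, hc⟩ := offer _ b h (fun _ _ => hb) w hw hwr
          have hcK : c ∈ K ∧ k c = k b := by
            rcases hc with hc | ⟨hc, hle⟩
            · exact ⟨hIK (mem_of_mem_needy hc), (forced c hc).trans hcr⟩
            · exact ⟨hJK (hGJ c hc), (ih _ (hle.trans_lt hlt) c hc rfl).trans hcr⟩
          obtain rfl := hk hcK.1 (hJK (hGJ b hb)) hcK.2
          exact (F.up_ne_of_dn h hcr).elim
    replace forcedG : ∀ b, G b → k b = F.up b := fun b hb => forcedG _ b hb rfl
    have stuck : ∀ n : ℕ, ∀ z ∈ K, z ∈ F.needy X → ¬ G z → (z ∈ I → k z ≠ pick z) →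
        F.depth z ≠ n := by
      intro n
      induction n using Nat.strong_induction_on with
      | _ n ih =>
        rintro z hzK hzN hGz hzI rfl
        rcases hkE z hzK with h | h
        · -- `z` takes its parent, which was kept by a vertex `u` of `I` that must now move.
          obtain ⟨u, hu, hpu, huI, hGu⟩ : ∃ u, F.dn (F.up z) = some u ∧ pick u = F.up z ∧ u ∈ I ∧
              ¬ G u := by
            by_contra! hc
            have hzI : z ∉ F.needy I := fun h => hGz (grantI z h)
            have hsel : ∃ b ∈ F.needy X, sel (F.up z) = b ∧ F.up b = F.up z := by
              by_cases hI : ∃ b ∈ F.needy I, F.up b = F.up z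
              · obtain ⟨b, hb, hbz⟩ := hI
                exact ⟨b, hmono hb, hbz ▸ selI' b hb, hbz⟩
              · push Not at hI
                obtain ⟨h1, h2, -⟩ := selX z hzN hI
                exact ⟨_, h1, rfl, h2⟩
            obtain ⟨b, hbN, hb, hbz⟩ := hsel
            have hGb : G b := by
              refine granted_iff.2 ⟨hbN, by rw [hbz, hb], fun u hu hpu huI => ?_⟩
              rw [hbz] at hu hpu
              exact hc u hu hpu huI
            have hbz' : b = z := hk (hJK (hGJ b hGb)) hzK (by rw [forcedG b hGb, hbz, h])
            exact hGz (hbz' ▸ hGb)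
          refine ih _ (F.depth_lt _ _ hu) u (hIK huI) (pick_needy u huI z hzN hpu) hGu ?_ rfl
          intro _ hku
          have : u = z := hk (hIK huI) hzK (by rw [hku, hpu, h])
          subst this
          exact F.up_ne_of_dn hu rfl
        · -- `z` takes a child, which is already needed further down.
          obtain ⟨w, hw, hwr, -⟩ := exists_rank_lt hzN h
          obtain ⟨c, hcr, hc⟩ := offer _ z h (fun h1 h2 => (hzI h2 h1.symm).elim) w hw hwr
          have hcK : c ∈ K ∧ k c = k z := by
            rcases hc with hc | ⟨hc, -⟩
            · exact ⟨hIK (mem_of_mem_needy hc), (forced c hc).trans hcr⟩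
            · exact ⟨hJK (hGJ c hc), (forcedG c hc).trans hcr⟩
          obtain rfl := hk hcK.1 hzK hcK.2
          exact F.up_ne_of_dn h hcr
    by_contra hzJ
    have hzX := hKX hzK
    simp only [J, mem_ofPred_eq, not_and, not_or, not_not] at hzJ
    obtain ⟨h1, h2, h3⟩ := hzJ hzX
    exact stuck _ z hzK h2 h1 (fun h => (h3 h).elim) rfl

end BipForest

/-! ### The matroid of the alternating dimaze of a rooted tree -/

namespace SimpleGraph.IsTree

variable {V : Type u} {T : SimpleGraph V}

/-- A vertex of a rooted tree has at most one neighbour closer to the root. -/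
lemma eq_of_adj_of_dist (hT : T.IsTree) {r v w w' : V} (hw : T.Adj v w) (hw' : T.Adj v w')
    (hd : T.dist r v = T.dist r w + 1) (hd' : T.dist r v = T.dist r w' + 1) : w = w' := by
  have key : ∀ w, T.Adj v w → T.dist r v = T.dist r w + 1 →
      ∃ p : T.Walk r v, p.IsPath ∧ p.penultimate = w := by
    intro w hw hd
    obtain ⟨p, hp⟩ := hT.connected.exists_walk_length_eq_dist r w
    refine ⟨p.concat hw.symm, ?_, by simp⟩
    refine Walk.isPath_of_length_eq_dist _ ?_
    simp [hp, hd]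
  obtain ⟨p, hp, rfl⟩ := key w hw hd
  obtain ⟨q, hq, rfl⟩ := key w' hw' hd'
  rw [(hT.existsUnique_path r v).unique hp hq]

lemma exists_adj_dist (hT : T.IsTree) {r v : V} (hv : v ≠ r) :
    ∃ w, T.Adj v w ∧ T.dist r v = T.dist r w + 1 := by
  obtain ⟨p, hp⟩ := hT.connected.exists_walk_length_eq_dist v r
  cases p with
  | nil => exact (hv rfl).elim
  | @cons _ w _ h p =>
    refine ⟨w, h, ?_⟩
    rcases hT.dist_eq_dist_add_one_of_adj r h with h' | h'
    · exact h'
    · have h1 := dist_le p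
      rw [Walk.length_cons, dist_comm] at hp
      rw [dist_comm] at h1
      omega

end SimpleGraph.IsTree

section Tree

variable {V : Type u} (T : SimpleGraph V) (r : V)

/-- The bipartite graph of the alternating dimaze: each vertex is joined to the exits that end a
path starting in it. These are the vertex itself or its neighbours. -/
def exitEdge (v e : V) : Prop := Even (T.dist r e) ∧ (v = e ∨ T.Adj v e)

variable {T r}

lemma even_dist_iff_of_adj (hT : T.IsTree) {v w : V} (h : T.Adj v w) :
    Even (T.dist r v) ↔ ¬ Even (T.dist r w) := by
  rcases hT.dist_eq_dist_add_one_of_adj r h with h | h <;> rw [h, Nat.even_add_one]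
  exact not_not.symm

lemma exitEdge_of_even (hT : T.IsTree) {v e : V} (h : exitEdge T r v e) (hv : Even (T.dist r v)) :
    e = v := by
  rcases h.2 with h' | h'
  · exact h'.symm
  · exact ((even_dist_iff_of_adj hT h').1 hv h.1).elim

lemma exitEdge_of_odd {v e : V} (h : exitEdge T r v e) (hv : ¬ Even (T.dist r v)) :
    T.Adj v e := by
  rcases h.2 with rfl | h'
  · exact (hv h.1).elim
  · exact h'

/-- A path of the alternating dimaze has at most one edge, so that linkages are matchings. -/
lemma linkable_iff_matchable (hT : T.IsTree) (A : Set V) :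
    (alternatingTreeDimaze T hT r).Linkable A ↔ Matchable (exitEdge T r) A := by
  classical
  constructor
  · rintro ⟨P, ⟨hP, hdisj⟩, rfl⟩
    have h : ∀ a, ∃ e, a ∈ {a | ∃ p ∈ P, p.head? = some a} →
        exitEdge T r a e ∧ ∃ p ∈ P, p.head? = some a ∧ e ∈ p := by
      intro a
      by_cases ha : a ∈ {a | ∃ p ∈ P, p.head? = some a}
      · obtain ⟨p, hp, hpa⟩ := ha
        obtain ⟨⟨hne, hnd, hch⟩, b, hb, hpb⟩ := hP p hp
        replace hb : Even (T.dist r b) := hb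
        refine ⟨b, fun _ => ⟨⟨hb, ?_⟩, p, hp, hpa, List.mem_of_getLast? hpb⟩⟩
        match p, hpa, hpb, hch with
        | [x], h1, h2, _ => left; simp_all
        | [x, y], h1, h2, h3 =>
          right
          simp only [List.head?_cons, Option.some.injEq, List.getLast?_cons_cons,
            List.getLast?_singleton] at h1 h2
          subst h1 h2
          exact (List.isChain_cons_cons.1 h3).1.1
        | x :: y :: z :: l, h1, h2, h3 =>
          exfalso
          have h4 := (List.isChain_cons_cons.1 h3).1
          have h5 := (List.isChain_cons_cons.1 (List.isChain_cons_cons.1 h3).2).1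
          exact (alternatingTreeDimaze T hT r).sink y h4.2 z h5
      · exact ⟨a, fun h => (ha h).elim⟩
    choose m hm using h
    refine ⟨m, ?_, fun a ha => (hm a ha).1⟩
    intro a ha b hb hab
    obtain ⟨p, hp, hpa, hmp⟩ := (hm a ha).2
    obtain ⟨q, hq, hqb, hmq⟩ := (hm b hb).2
    by_cases hpq : p = q
    · subst hpq
      exact Option.some.inj (hpa.symm.trans hqb)
    · exact (hdisj hp hq hpq hmp (hab ▸ hmq)).elim
  · rintro ⟨m, hm, hmE⟩
    let path : V → List V := fun a => if m a = a then [a] else [a, m a]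
    have hmem : ∀ a x, x ∈ path a ↔ x = a ∨ x = m a := by
      intro a x
      by_cases h : m a = a <;> simp [path, h]
    have hhead : ∀ a, (path a).head? = some a := by
      intro a
      by_cases h : m a = a <;> simp [path, h]
    -- A matched exit that lies in `A` is matched to itself.
    have hself : ∀ a ∈ A, ∀ b ∈ A, a = m b → a = b := by
      rintro a ha b hb rfl
      exact hm ha hb (exitEdge_of_even hT (hmE _ ha) (hmE b hb).1)
    refine ⟨path '' A, ⟨?_, ?_⟩, ?_⟩
    · rintro _ ⟨a, ha, rfl⟩
      obtain ⟨he, h⟩ := hmE a ha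
      refine ⟨?_, m a, he, ?_⟩
      · by_cases h' : m a = a
        · simp [path, h', Digraph.IsDiPath]
        · have hadj : T.Adj a (m a) := h.resolve_left (Ne.symm h')
          have hadj' : (alternatingTreeDimaze T hT r).digraph.Adj a (m a) := ⟨hadj, he⟩
          simp [path, h', Digraph.IsDiPath, Ne.symm h', hadj']
      · by_cases h' : m a = a <;> simp [path, h']
    · rintro _ ⟨a, ha, rfl⟩ _ ⟨b, hb, rfl⟩ hne x hxa hxb
      rw [hmem] at hxa hxb
      refine hne (congrArg path ?_)
      rcases hxa with rfl | rfl <;> rcases hxb with h | h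
      · exact h
      · exact hself _ ha _ hb h
      · exact (hself _ hb _ ha h.symm).symm
      · exact hm ha hb h
    · ext a
      simp only [mem_ofPred_eq]
      constructor
      · rintro ⟨_, ⟨b, hb, rfl⟩, h⟩
        rw [hhead] at h
        exact Option.some.inj h ▸ hb
      · exact fun ha => ⟨_, ⟨a, ha, rfl⟩, hhead a⟩

/-- The graph `exitEdge` as a rooted forest. The left copy of an exit `e` is a leaf attached to
`e`. -/
lemma exists_bipForest (hT : T.IsTree) (r : V) :
    ∃ F : BipForest V V, F.Edge = exitEdge T r := by
  classical
  choose! par hadj hdist using fun v (hv : v ≠ r) => hT.exists_adj_dist hv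
  have hodd : ∀ {v}, ¬ Even (T.dist r v) → v ≠ r := by
    rintro v hv rfl
    simp at hv
  refine ⟨⟨fun v => if Even (T.dist r v) then v else par v,
    fun e => if Even (T.dist r e) ∧ e ≠ r then some (par e) else none, T.dist r, ?_⟩, ?_⟩
  · intro l l' h
    by_cases hl : Even (T.dist r l)
    · simp only [hl, if_true] at h
      split_ifs at h with h'
      rw [← Option.some.inj h, hdist _ h'.2]
      omega
    · simp only [hl, if_false] at h
      split_ifs at h with h'
      have h1 := hdist _ (hodd hl)
      have h2 := hdist _ h'.2
      rw [← Option.some.inj h]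
      omega
  · ext v e
    simp only [BipForest.Edge, exitEdge]
    constructor
    · rintro (h | h)
      · split_ifs at h with hv
        · subst h; exact ⟨hv, .inl rfl⟩
        · subst h
          have h1 := hadj _ (hodd hv)
          exact ⟨by_contra fun h2 => hv ((even_dist_iff_of_adj hT h1).2 h2), .inr h1⟩
      · split_ifs at h with he
        obtain rfl := Option.some.inj h
        exact ⟨he.1, .inr (hadj _ he.2).symm⟩
    · rintro ⟨he, rfl | h⟩
      · simp [he]
      · have hv : ¬ Even (T.dist r v) := fun hv => (even_dist_iff_of_adj hT h).1 hv he
        rcases hT.dist_eq_dist_add_one_of_adj r h with hd | hd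
        · left
          simp only [hv, if_false]
          exact hT.eq_of_adj_of_dist (hadj _ (hodd hv)) h (hdist _ (hodd hv)) hd
        · right
          have her : e ≠ r := by rintro rfl; simp at hd
          rw [if_pos ⟨he, her⟩]
          exact congrArg some (hT.eq_of_adj_of_dist (hadj _ her) h.symm (hdist _ her) hd)

theorem exists_defines (hT : T.IsTree) (r : V) :
    ∃ M : Matroid V, (alternatingTreeDimaze T hT r).Defines M := by
  obtain ⟨F, hF⟩ := exists_bipForest hT r
  let N : IndepMatroid V :=
    { E := univ
      Indep := Matchable (exitEdge T r)
      indep_empty := ⟨id, by simp, by simp⟩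
      indep_subset := fun _ _ hJ h => hJ.mono h
      indep_aug := fun _ _ hI hI' hB => hI.exists_insert hI' hB
      indep_maximal := fun X _ => hF ▸ F.existsMaximalSubsetProperty_matchable X
      subset_ground := fun _ _ => subset_univ _ }
  exact ⟨N.matroid, rfl, fun I => (linkable_iff_matchable hT I).symm⟩

end Tree

/-! ### Independence in the dual matroid -/

section Dual

variable {V : Type u} {T : SimpleGraph V} {hT : T.IsTree} {r : V} {M : Matroid V}

lemma Dimaze.Defines.indep_iff (hM : (alternatingTreeDimaze T hT r).Defines M) {I : Set V} :
    M.Indep I ↔ Matchable (exitEdge T r) I :=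
  (hM.2 I).trans (linkable_iff_matchable hT I)

lemma Dimaze.Defines.isBase_iff (hM : (alternatingTreeDimaze T hT r).Defines M) {B : Set V} :
    M.IsBase B ↔ Maximal (Matchable (exitEdge T r)) B := by
  rw [Matroid.isBase_iff_maximal_indep]
  simp only [Maximal, hM.indep_iff]

lemma Dimaze.Defines.dual_indep_iff (hM : (alternatingTreeDimaze T hT r).Defines M) {I : Set V} :
    M✶.Indep I ↔ ∃ B, M.IsBase B ∧ Disjoint I B :=
  Matroid.dual_indep_iff_exists (by simp [hM.1])

/-- A matching of a base covers all exits, as an uncovered exit could be added to the base. -/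
lemma Dimaze.Defines.exists_eq_of_isBase (hM : (alternatingTreeDimaze T hT r).Defines M)
    {B : Set V} (hB : M.IsBase B) {m : V → V} (hm : InjOn m B)
    (hmE : ∀ b ∈ B, exitEdge T r b (m b)) {e : V} (he : Even (T.dist r e)) :
    ∃ b ∈ B, m b = e := by
  by_contra! h
  have h1 := Matchable.insert_of_free hm hmE (x := e) ⟨he, .inl rfl⟩ h
  have h2 : e ∈ B := (hM.isBase_iff.1 hB).le_of_ge h1 (subset_insert _ _) (mem_insert _ _)
  exact h e h2 (exitEdge_of_even hT (hmE e h2) he)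

/-- If `A` is independent in the dual, then a base avoiding `A` matches a private neighbour outside
`A` to every exit in `A`. -/
lemma Dimaze.Defines.exists_injOn_of_dual_indep (hM : (alternatingTreeDimaze T hT r).Defines M)
    {A : Set V} (hA : M✶.Indep A) : ∃ g : V → V, InjOn g {e ∈ A | Even (T.dist r e)} ∧
      ∀ e ∈ A, Even (T.dist r e) → T.Adj e (g e) ∧ g e ∉ A := by
  obtain ⟨B, hB, hAB⟩ := hM.dual_indep_iff.1 hA
  obtain ⟨m, hm, hmE⟩ := hM.indep_iff.1 hB.indep
  choose! g hgB hg using fun e he => hM.exists_eq_of_isBase hB hm hmE (e := e) he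
  refine ⟨g, fun e he e' he' h => ?_, fun e he hev => ⟨?_, fun h => ?_⟩⟩
  · rw [← hg e he.2, ← hg e' he'.2, h]
  · have h := hmE _ (hgB e hev)
    rw [hg e hev] at h
    rcases h.2 with h' | h'
    · exact (hAB.le_bot ⟨he, h' ▸ hgB e hev⟩).elim
    · exact h'.symm
  · exact hAB.le_bot ⟨h, hgB e hev⟩

/-- Replacing the exits in `Z`, all on the same level, by one child of each in the set of all exits
gives a base. -/
lemma Dimaze.Defines.isBase_exchange (hM : (alternatingTreeDimaze T hT r).Defines M) {Z : Set V}
    {n : ℕ} (hn : Even n) (hZ : ∀ z ∈ Z, T.dist r z = n) {c : V → V}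
    (hc : ∀ z ∈ Z, T.Adj z (c z) ∧ T.dist r (c z) = T.dist r z + 1) :
    M.IsBase ({e | Even (T.dist r e) ∧ e ∉ Z} ∪ c '' Z) := by
  classical
  have : Nonempty V := ⟨r⟩
  have hZe : ∀ z ∈ Z, Even (T.dist r z) := fun z hz => hZ z hz ▸ hn
  have hodd : ∀ z ∈ Z, ¬ Even (T.dist r (c z)) := fun z hz =>
    (even_dist_iff_of_adj hT (hc z hz).1).1 (hZe z hz)
  have hcz : ∀ z ∈ Z, ∀ z' ∈ Z, T.Adj (c z) z' → z' = z := by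
    intro z hz z' hz' h
    refine hT.eq_of_adj_of_dist h (hc z hz).1.symm ?_ (hc z hz).2
    rw [(hc z hz).2, hZ z hz, hZ z' hz']
  have hcinj : InjOn c Z := fun z hz z' hz' h =>
    (hcz z hz z' hz' (h ▸ (hc z' hz').1.symm)).symm
  rw [hM.isBase_iff]
  refine ⟨⟨fun b => if Even (T.dist r b) then b else Function.invFunOn c Z b, ?_, ?_⟩, ?_⟩
  · rintro _ (⟨he, heZ⟩ | ⟨z, hz, rfl⟩) _ (⟨he', heZ'⟩ | ⟨z', hz', rfl⟩) h
    · simpa [he, he'] using h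
    · simp only [he, hodd z' hz', if_true, if_false, hcinj.leftInvOn_invFunOn hz'] at h
      exact (heZ (h ▸ hz')).elim
    · simp only [he', hodd z hz, if_true, if_false, hcinj.leftInvOn_invFunOn hz] at h
      exact (heZ' (h ▸ hz)).elim
    · simp only [hodd z hz, hodd z' hz', if_false, hcinj.leftInvOn_invFunOn hz,
        hcinj.leftInvOn_invFunOn hz'] at h
      rw [h]
  · rintro _ (⟨he, heZ⟩ | ⟨z, hz, rfl⟩)
    · simp [he, exitEdge]
    · simp only [hodd z hz, if_false, hcinj.leftInvOn_invFunOn hz]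
      exact ⟨hZe z hz, .inr (hc z hz).1.symm⟩
  · rintro K ⟨k, hk, hkE⟩ hBK
    have hself : ∀ x ∈ K, Even (T.dist r x) → k x = x := fun x hx he =>
      exitEdge_of_even hT (hkE x hx) he
    -- All exits outside `Z` lie in `K` and are matched to themselves, so only `Z` is left.
    have hkZ : ∀ x ∈ K, ¬ Even (T.dist r x) → k x ∈ Z := by
      intro x hx hxo
      by_contra hkx
      have he := (hkE x hx).1
      have hmem : k x ∈ K := hBK (.inl ⟨he, hkx⟩)
      exact hxo (hk hmem hx (hself _ hmem he) ▸ he)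
    have hkc : ∀ z ∈ Z, k (c z) = z := by
      intro z hz
      have hmem : c z ∈ K := hBK (.inr ⟨z, hz, rfl⟩)
      exact hcz z hz _ (hkZ _ hmem (hodd z hz)) (exitEdge_of_odd (hkE _ hmem) (hodd z hz))
    intro x hx
    by_cases he : Even (T.dist r x)
    · refine .inl ⟨he, fun hxZ => ?_⟩
      have := hk (hBK (.inr ⟨x, hxZ, rfl⟩)) hx ((hkc x hxZ).trans (hself x hx he).symm)
      exact hodd x hxZ (by rwa [this])
    · have hz := hkZ x hx he
      exact .inr ⟨_, hz, hk (hBK (.inr ⟨_, hz, rfl⟩)) hx (hkc _ hz)⟩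

lemma Dimaze.Defines.dual_indep_odd (hM : (alternatingTreeDimaze T hT r).Defines M) :
    M✶.Indep {o | ¬ Even (T.dist r o)} := by
  have h := hM.isBase_exchange (Z := ∅) (n := 0) (c := id) (by simp) (by simp) (by simp)
  refine hM.dual_indep_iff.2 ⟨_, h, disjoint_left.2 ?_⟩
  rintro o ho (h' | h')
  · exact ho h'.1
  · simp at h'

lemma Dimaze.Defines.dual_indep_level (hM : (alternatingTreeDimaze T hT r).Defines M)
    (hinf : ∀ v : V, {w : V | T.Adj v w ∧ T.dist r w = T.dist r v + 1}.Infinite) {Z : Set V}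
    {n : ℕ} (hn : Even n) (hZ : ∀ z ∈ Z, T.dist r z = n) : M✶.Indep Z := by
  choose c hc using fun v => (hinf v).nonempty
  refine hM.dual_indep_iff.2 ⟨_, hM.isBase_exchange hn hZ fun z _ => hc z, disjoint_left.2 ?_⟩
  rintro z hz (h | ⟨z', hz', rfl⟩)
  · exact h.2 hz
  · have h1 := (hc z').2
    have h2 := hZ _ hz
    have h3 := hZ _ hz'
    omega

/-- Let `e 0, o 0, e 1, o 1, …` be a ray going away from the root. A set that contains all exits
`e i` and all their neighbours outside the ray is dependent in the dual. Indeed a base avoiding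
it has to match `o i` to `e i` for all `i`, but matching `o i` to `e (i + 1)` instead would
leave `e 0` free. -/
lemma Dimaze.Defines.not_dual_indep_of_ray (hM : (alternatingTreeDimaze T hT r).Defines M)
    {e o : ℕ → V} (he : ∀ i, Even (T.dist r (e i))) (heo : ∀ i, T.dist r (o i) = T.dist r (e i) + 1)
    (hoe : ∀ i, T.Adj (o i) (e (i + 1)) ∧ T.dist r (e (i + 1)) = T.dist r (o i) + 1)
    {A : Set V} (heA : ∀ i, e i ∈ A) (hoA : ∀ i x, T.Adj (e i) x → (∀ j, x ≠ o j) → x ∈ A) :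
    ¬ M✶.Indep A := by
  classical
  intro hA
  obtain ⟨B, hB, hAB⟩ := hM.dual_indep_iff.1 hA
  obtain ⟨m, hm, hmE⟩ := hM.indep_iff.1 hB.indep
  have hde : ∀ i, T.dist r (e i) = T.dist r (e 0) + 2 * i := by
    intro i
    induction i with
    | zero => rfl
    | succ i ih => have := heo i; have := (hoe i).2; omega
  have key : ∀ i, ∃ j, o j ∈ B ∧ m (o j) = e i ∧ (i = j ∨ i = j + 1) := by
    intro i
    obtain ⟨b, hb, hbe⟩ := hM.exists_eq_of_isBase hB hm hmE (he i)
    have hadj : T.Adj (e i) b := by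
      rcases (hmE b hb).2 with h | h
      · exact (hAB.le_bot ⟨heA i, hbe ▸ h ▸ hb⟩).elim
      · exact (hbe ▸ h).symm
    obtain ⟨j, rfl⟩ : ∃ j, b = o j := by
      by_contra! hj
      exact hAB.le_bot ⟨hoA i b hadj hj, hb⟩
    refine ⟨j, hb, hbe, ?_⟩
    have h1 := heo j
    have h2 := hde i
    have h3 := hde j
    rcases hT.dist_eq_dist_add_one_of_adj r hadj with h | h <;> omega
  have hmo : ∀ i, o i ∈ B ∧ m (o i) = e i := by
    intro i
    induction i with
    | zero =>
      obtain ⟨j, hj, hje, h⟩ := key 0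
      obtain rfl : j = 0 := by omega
      exact ⟨hj, hje⟩
    | succ i ih =>
      obtain ⟨j, hj, hje, rfl | h⟩ := key (i + 1)
      · exact ⟨hj, hje⟩
      · obtain rfl : i = j := by omega
        have h1 := hde i
        have h2 := hde (i + 1)
        rw [← hje, ih.2] at h2
        omega
  have hoinj : ∀ i j, o i = o j → i = j := by
    intro i j h
    have h1 := heo i
    have h2 := heo j
    have h3 := hde i
    have h4 := hde j
    rw [h] at h1
    omega
  let s : V → V := fun b => if h : ∃ i, b = o i then e (h.choose + 1) else m b
  have hso : ∀ i, s (o i) = e (i + 1) := by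
    intro i
    have h : ∃ j, o i = o j := ⟨i, rfl⟩
    simp only [s, h, dif_pos]
    rw [← hoinj _ _ h.choose_spec]
  have hs : ∀ b, (∀ i, b ≠ o i) → s b = m b := by
    intro b hb
    simp [s, hb]
  have heinj : ∀ i j, e i = e j → i = j := by
    intro i j h
    have h3 := hde i
    have h4 := hde j
    rw [h] at h3
    omega
  have hsE : ∀ b ∈ B, exitEdge T r b (s b) := by
    intro b hb
    by_cases h : ∃ i, b = o i
    · obtain ⟨i, rfl⟩ := h
      rw [hso]
      exact ⟨he _, .inr (hoe i).1⟩
    · push Not at h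
      rw [hs b h]
      exact hmE b hb
  have hme : ∀ b ∈ B, ∀ i, m b = e i → b = o i := fun b hb i h =>
    hm hb (hmo i).1 (h.trans (hmo i).2.symm)
  have hsinj : InjOn s B := by
    intro a ha b hb hab
    by_cases h : ∃ i, a = o i <;> by_cases h' : ∃ i, b = o i
    · obtain ⟨i, rfl⟩ := h
      obtain ⟨j, rfl⟩ := h'
      rw [hso, hso] at hab
      rw [Nat.succ_injective (heinj _ _ hab)]
    · obtain ⟨i, rfl⟩ := h
      push Not at h'
      rw [hso, hs b h'] at hab
      exact (h' _ (hme b hb _ hab.symm)).elim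
    · obtain ⟨i, rfl⟩ := h'
      push Not at h
      rw [hso, hs a h] at hab
      exact (h _ (hme a ha _ hab)).elim
    · push Not at h h'
      rw [hs a h, hs b h'] at hab
      exact hm ha hb hab
  obtain ⟨b, hb, hbe⟩ := hM.exists_eq_of_isBase hB hsinj hsE (he 0)
  by_cases h : ∃ i, b = o i
  · obtain ⟨i, rfl⟩ := h
    rw [hso] at hbe
    exact absurd (heinj _ _ hbe) (by omega)
  · push Not at h
    rw [hs b h] at hbe
    exact h _ (hme b hb _ hbe)

end Dual

/-! ### Linkages and rerouting -/

namespace Dimaze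

variable {V : Type u} {W : Type v} {D : Dimaze W} {φ : V → W}

/-- `p` is a path of the dimaze from `a` to an exit. -/
def IsExitPath (D : Dimaze W) (a : W) (p : List W) : Prop :=
  D.digraph.IsDiPath p ∧ p.head? = some a ∧ ∃ b ∈ D.exits, p.getLast? = some b

/-- The paths `p b`, for `b ∈ B`, form a linkage from `φ '' B` to the exits; `p b` starts in `φ b`.
Outside `B` the values of `p` do not matter. -/
def LinkedBy (D : Dimaze W) (φ : V → W) (B : Set V) (p : V → List W) : Prop :=
  (∀ b ∈ B, D.IsExitPath (φ b) (p b)) ∧ ∀ a ∈ B, ∀ b ∈ B, a ≠ b → (p a).Disjoint (p b)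

lemma linkable_image_iff (hφ : Function.Injective φ) (B : Set V) :
    D.Linkable (φ '' B) ↔ ∃ p, D.LinkedBy φ B p := by
  constructor
  · rintro ⟨P, ⟨hP, hdisj⟩, hPB⟩
    have h : ∀ b, ∃ p, b ∈ B → p ∈ P ∧ p.head? = some (φ b) := by
      intro b
      by_cases hb : b ∈ B
      · obtain ⟨p, hp⟩ := hPB.symm.subset (mem_image_of_mem φ hb)
        exact ⟨p, fun _ => hp⟩
      · exact ⟨[], fun h => (hb h).elim⟩
    choose p hp using h
    refine ⟨p, fun b hb => ⟨(hP _ (hp b hb).1).1, (hp b hb).2, (hP _ (hp b hb).1).2⟩,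
      fun a ha b hb hab => hdisj (hp a ha).1 (hp b hb).1 fun h => hab (hφ ?_)⟩
    exact Option.some.inj ((hp a ha).2.symm.trans (h ▸ (hp b hb).2))
  · rintro ⟨p, hp, hdisj⟩
    refine ⟨p '' B, ⟨?_, ?_⟩, ?_⟩
    · rintro _ ⟨b, hb, rfl⟩
      exact ⟨(hp b hb).1, (hp b hb).2.2⟩
    · rintro _ ⟨a, ha, rfl⟩ _ ⟨b, hb, rfl⟩ hab
      exact hdisj a ha b hb fun h => hab (h ▸ rfl)
    · ext w
      constructor
      · rintro ⟨_, ⟨b, hb, rfl⟩, h⟩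
        exact ⟨b, hb, Option.some.inj ((hp b hb).2.1.symm.trans h)⟩
      · rintro ⟨b, hb, rfl⟩
        exact ⟨_, ⟨b, hb, rfl⟩, (hp b hb).2.1⟩

lemma _root_.List.exists_first_mem {α : Type v} (l : List α) (S : Set α) :
    (∀ x ∈ l, x ∉ S) ∨ ∃ l₁ x l₂, l = l₁ ++ x :: l₂ ∧ x ∈ S ∧ ∀ y ∈ l₁, y ∉ S := by
  induction l with
  | nil => left; simp
  | cons a l ih =>
    by_cases ha : a ∈ S
    · exact .inr ⟨[], a, l, rfl, ha, by simp⟩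
    · rcases ih with h | ⟨l₁, x, l₂, rfl, hx, h⟩
      · left
        simpa [ha] using h
      · exact .inr ⟨a :: l₁, x, l₂, rfl, hx, by simpa [ha] using h⟩

/-- `q'` arises from the path `q` by switching to the linkage `p` of `B` at the first opportunity:
it avoids all paths of the linkage, except that it shares vertices with the path starting in
the at most one element of `S`, which is a path that `q` meets. -/
structure IsReroute (D : Dimaze W) (B : Set V) (p : V → List W) (a : W) (q q' : List W)
    (S : Set V) : Prop where
  isExitPath : D.IsExitPath a q'
  subset : S ⊆ B
  subsingleton : S.Subsingleton
  mem : ∀ x ∈ q', (x ∈ q ∧ ∀ b ∈ B, x ∉ p b) ∨ ∃ b ∈ S, x ∈ p b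
  meets : ∀ b ∈ S, ∃ x ∈ q, x ∈ p b

lemma LinkedBy.exists_isReroute {B : Set V} {p : V → List W} (hp : D.LinkedBy φ B p) {a : W}
    {q : List W} (hq : D.IsExitPath a q) : ∃ q' S, D.IsReroute B p a q q' S := by
  rcases q.exists_first_mem {x | ∃ b ∈ B, x ∈ p b} with h | ⟨q₁, x, q₂, rfl, ⟨b, hb, hxb⟩, h⟩
  · exact ⟨q, ∅, hq, empty_subset _, subsingleton_empty,
      fun x hx => .inl ⟨hx, fun b hb hxb => h x hx ⟨b, hb, hxb⟩⟩, by simp⟩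
  · obtain ⟨p₁, p₂, hpb⟩ := List.append_of_mem hxb
    obtain ⟨⟨-, hqn, hqc⟩, hqa, -⟩ := hq
    obtain ⟨⟨-, hpn, hpc⟩, -, z, hz, hpz⟩ := hp.1 b hb
    rw [hpb] at hpn hpc hpz
    refine ⟨q₁ ++ x :: p₂, {b}, ⟨⟨by simp, ?_, ?_⟩, ?_, z, hz, ?_⟩, by simpa using hb,
      subsingleton_singleton, ?_, ?_⟩
    · refine List.Nodup.append (List.nodup_append.1 hqn).1 (List.nodup_append.1 hpn).2.1 ?_
      intro y hy hy'
      exact h y hy ⟨b, hb, hpb ▸ List.mem_append_right _ hy'⟩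
    · rw [List.isChain_split] at hqc hpc ⊢
      exact ⟨hqc.1, hpc.2⟩
    · cases q₁ <;> simpa using hqa
    · simpa using hpz
    · intro y hy
      rcases List.mem_append.1 hy with hy | hy
      · exact .inl ⟨List.mem_append_left _ hy, fun c hc hyc => h y hy ⟨c, hc, hyc⟩⟩
      · exact .inr ⟨b, rfl, hpb ▸ List.mem_append_right _ hy⟩
    · rintro _ rfl
      exact ⟨x, by simp, hxb⟩

/-- Disjoint paths that were rerouted into different paths of a linkage can replace these. -/
lemma LinkedBy.reroute {B Z : Set V} {p q q' : V → List W}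
    {S : V → Set V} [DecidablePred (· ∈ Z)] (hp : D.LinkedBy φ B p)
    (hq : ∀ a ∈ Z, ∀ b ∈ Z, a ≠ b → (q a).Disjoint (q b))
    (hq' : ∀ a ∈ Z, D.IsReroute B p (φ a) (q a) (q' a) (S a))
    (hS : ∀ a ∈ Z, ∀ b ∈ Z, a ≠ b → Disjoint (S a) (S b)) :
    D.LinkedBy φ (Z ∪ (B \ ⋃ a ∈ Z, S a)) (fun v => if v ∈ Z then q' v else p v) := by
  have hmix : ∀ a ∈ Z, ∀ b ∈ B, b ∉ S a → (q' a).Disjoint (p b) := by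
    intro a ha b hb hbS x hx hxb
    rcases (hq' a ha).mem x hx with h | ⟨c, hc, hxc⟩
    · exact h.2 b hb hxb
    · refine hp.2 c ((hq' a ha).subset hc) b hb ?_ hxc hxb
      rintro rfl
      exact hbS hc
  refine ⟨fun b hb => ?_, fun a ha b hb hab => ?_⟩
  · by_cases hbZ : b ∈ Z
    · simpa [hbZ] using (hq' b hbZ).isExitPath
    · simpa [hbZ] using hp.1 b (hb.resolve_left hbZ).1
  · by_cases haZ : a ∈ Z <;> by_cases hbZ : b ∈ Z <;> simp only [haZ, hbZ, if_true, if_false]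
    · intro x hxa hxb
      rcases (hq' a haZ).mem x hxa with h | ⟨c, hc, hxc⟩
      · rcases (hq' b hbZ).mem x hxb with h' | ⟨d, hd, hxd⟩
        · exact hq a haZ b hbZ hab h.1 h'.1
        · exact h.2 d ((hq' b hbZ).subset hd) hxd
      · refine hmix b hbZ c ((hq' a haZ).subset hc) ?_ hxb hxc
        exact disjoint_left.1 (hS a haZ b hbZ hab) hc
    · have hb' := hb.resolve_left hbZ
      exact hmix a haZ b hb'.1 fun h => hb'.2 (mem_biUnion haZ h)
    · have ha' := ha.resolve_left haZ
      exact (hmix b hbZ a ha'.1 fun h => ha'.2 (mem_biUnion hbZ h)).symm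
    · exact hp.2 a (ha.resolve_left haZ).1 b (hb.resolve_left hbZ).1 hab

end Dimaze

/-- A gammoid with ground set `univ` is embedded into the linkability structure of some dimaze. -/
lemma Matroid.IsGammoid.exists_dimaze {V : Type u} {M : Matroid V} (h : IsGammoid.{u, v} M)
    (hM : M.E = univ) : ∃ (W : Type v) (D : Dimaze W) (φ : V → W), Function.Injective φ ∧
      ∀ I : Set V, M.Indep I ↔ D.Linkable (φ '' I) := by
  obtain ⟨β, N, X, ⟨W, D, N', hD, e₂, he₂⟩, hX, e₁, he₁⟩ := h
  have hmem : ∀ x, x ∈ M.E := by simp [hM]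
  let ψ : V → N.E := fun x => ⟨e₁ ⟨x, hmem x⟩, hX (e₁ ⟨x, hmem x⟩).2⟩
  refine ⟨W, D, fun x => e₂ (ψ x), ?_, fun I => ?_⟩
  · intro x y hxy
    have h1 := e₂.injective (Subtype.val_injective hxy)
    have h2 := e₁.injective (Subtype.val_injective (congrArg (fun z : N.E => z.1) h1))
    exact congrArg Subtype.val h2
  · have h1 := he₁ (Subtype.val ⁻¹' I)
    have h2 := he₂ (ψ '' I)
    have e1 : (Subtype.val '' (Subtype.val ⁻¹' I : Set M.E)) = I := by
      rw [Subtype.image_preimage_coe, hM, univ_inter]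
    have e2 : (Subtype.val '' (e₁ '' (Subtype.val ⁻¹' I : Set M.E)) : Set β)
        = Subtype.val '' (ψ '' I) := by
      ext y
      constructor
      · rintro ⟨_, ⟨x, hx, rfl⟩, rfl⟩
        exact ⟨_, ⟨x.1, hx, rfl⟩, rfl⟩
      · rintro ⟨_, ⟨x, hx, rfl⟩, rfl⟩
        exact ⟨_, ⟨⟨x, hmem x⟩, hx, rfl⟩, rfl⟩
    have e3 : (Subtype.val '' (ψ '' I) : Set β) ⊆ X := by
      rintro _ ⟨_, ⟨x, -, rfl⟩, rfl⟩
      exact (e₁ ⟨x, hmem x⟩).2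
    rw [e1, e2, Matroid.restrict_indep_iff, and_iff_left e3] at h1
    rw [h1, h2, hD.2, image_image, image_image]

/-! ### The dual is not a gammoid -/

section NotGammoid

variable {V : Type u} {W : Type v} {T : SimpleGraph V} {hT : T.IsTree} {r : V} {M : Matroid V}
  {D : Dimaze W} {φ : V → W}

/-- A finite stage of the construction of a ray `e₀, o₀, e₁, o₁, …` going away from the root: `evs`
and `ods` are the sets of its even and odd vertices, `e` and `o` are the last ones, and `p` is a
linkage of the set obtained from the odd vertices of the tree by exchanging `ods` for `evs`. -/
structure RayStage (T : SimpleGraph V) (r : V) (D : Dimaze W) (φ : V → W) where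
  /-- the even vertices of the ray -/
  evs : Finset V
  /-- the odd vertices of the ray -/
  ods : Finset V
  /-- the last even vertex -/
  e : V
  /-- the last odd vertex -/
  o : V
  /-- the linkage -/
  p : V → List W
  e_even : Even (T.dist r e)
  adj : T.Adj e o
  dist_o : T.dist r o = T.dist r e + 1
  even_of_mem : ∀ x ∈ evs, Even (T.dist r x)
  dist_evs : ∀ x ∈ evs, T.dist r x ≤ T.dist r o
  dist_ods : ∀ x ∈ ods, T.dist r x ≤ T.dist r o
  card_eq : evs.card = ods.card
  linked : D.LinkedBy φ (↑evs ∪ {x | ¬ Even (T.dist r x) ∧ x ∉ ods}) p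

lemma RayStage.o_odd (s : RayStage T r D φ) : ¬ Even (T.dist r s.o) := by
  rw [s.dist_o, Nat.even_add_one, not_not]
  exact s.e_even

/-- The first stage. A path starting in the root is rerouted into a linkage of the odd
vertices; it ends up in the path of a child of the root, because otherwise the set of the root and
all its neighbours would be independent. -/
lemma exists_rayStage (hM : (alternatingTreeDimaze T hT r).Defines M)
    (hinf : ∀ v : V, {w : V | T.Adj v w ∧ T.dist r w = T.dist r v + 1}.Infinite)
    (hφ : Function.Injective φ) (hD : ∀ I, M✶.Indep I ↔ D.Linkable (φ '' I)) :
    ∃ s : RayStage T r D φ, s.evs = {s.e} ∧ s.ods = {s.o} := by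
  classical
  obtain ⟨p, hp⟩ := (D.linkable_image_iff hφ _).1 ((hD _).1 hM.dual_indep_odd)
  have hr : Even (T.dist r r) := by simp
  obtain ⟨q, hq⟩ := (D.linkable_image_iff hφ {r}).1 ((hD _).1
    (hM.dual_indep_level hinf hr fun z hz => by rw [mem_singleton_iff.1 hz]))
  obtain ⟨q', S, hS⟩ := hp.exists_isReroute (hq.1 r rfl)
  have hl := hp.reroute (Z := {r}) (q := q) (q' := fun _ => q') (S := fun _ => S) hq.2
    (fun a ha => by rw [mem_singleton_iff.1 ha]; exact hS)
    (fun a ha b hb hab => (hab (ha.trans hb.symm)).elim)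
  obtain ⟨g, -, hg⟩ := hM.exists_injOn_of_dual_indep
    ((hD _).2 ((D.linkable_image_iff hφ _).2 ⟨_, hl⟩))
  obtain ⟨hadj, hgr⟩ := hg r (.inl rfl) hr
  have hgo : ¬ Even (T.dist r (g r)) := (even_dist_iff_of_adj hT hadj).1 hr
  have hgS : g r ∈ S := by
    by_contra h
    exact hgr (.inr ⟨hgo, by simpa using h⟩)
  have hSe : S = {g r} := hS.subsingleton.eq_singleton_of_mem hgS
  have hdist : T.dist r (g r) = T.dist r r + 1 := by
    rcases hT.dist_eq_dist_add_one_of_adj r hadj with h | h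
    · simp at h
    · exact h
  refine ⟨⟨{r}, {g r}, r, g r, fun v => if v ∈ ({r} : Set V) then q' else p v,
    hr, hadj, hdist, by simp, by simp, by simp, by simp, ?_⟩,
    rfl, rfl⟩
  · convert hl using 1
    ext x
    simp [hSe]

/-- The ray can be prolonged by two vertices `e`, `o` so that only the path of `o` changes: it
is replaced by a path starting in `e`.

The infinitely many children `e` of the last odd vertex `s.o` form an independent set, so there are
disjoint paths starting in them. Each of these is rerouted into the linkage. If it does not end up
in the path of a child of `e`, then it ends up in the path of a vertex no farther from the root than
`s.o`, since otherwise the `evs.card + 1` exits `e` and `evs` would need private neighbours in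
`ods`. Suppose that this happens for all `e`. A path is finite and so cannot be met by all of the
disjoint paths. So there are `e ≠ e'` ending up in different paths; rerouting both gives an
independent set that contains `e`, `e'` and all their neighbours except `s.o`, and they cannot both
have `s.o` as private neighbour. -/
lemma RayStage.exists_next (hM : (alternatingTreeDimaze T hT r).Defines M)
    (hinf : ∀ v : V, {w : V | T.Adj v w ∧ T.dist r w = T.dist r v + 1}.Infinite)
    (hφ : Function.Injective φ) (hD : ∀ I, M✶.Indep I ↔ D.Linkable (φ '' I))
    (s : RayStage T r D φ) : ∃ t : RayStage T r D φ, T.Adj s.o t.e ∧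
      T.dist r t.e = T.dist r s.o + 1 ∧ (∀ x, x ∈ t.evs ↔ x = t.e ∨ x ∈ s.evs) ∧
      (∀ x, x ∈ t.ods ↔ x = t.o ∨ x ∈ s.ods) ∧ ∀ x, x ≠ t.e → t.p x = s.p x := by
  classical
  set B : Set V := ↑s.evs ∪ {x | ¬ Even (T.dist r x) ∧ x ∉ s.ods} with hB
  have hp := s.linked
  rw [← hB] at hp
  have ho := s.o_odd
  let Z : Set V := {w : V | T.Adj s.o w ∧ T.dist r w = T.dist r s.o + 1}
  have hZe : ∀ z ∈ Z, Even (T.dist r z) := by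
    intro z hz
    rw [hz.2, Nat.even_add_one]
    exact ho
  obtain ⟨q, hq⟩ := (D.linkable_image_iff hφ Z).1 ((hD _).1
    (hM.dual_indep_level hinf (Nat.even_add_one.2 ho) fun z hz => hz.2))
  choose! q' S hS using fun z (hz : z ∈ Z) => hp.exists_isReroute (hq.1 z hz)
  have hindep : ∀ Y ⊆ Z, (∀ a ∈ Y, ∀ b ∈ Y, a ≠ b → Disjoint (S a) (S b)) →
      M✶.Indep (Y ∪ (B \ ⋃ a ∈ Y, S a)) := fun Y hY hd =>
    (hD _).2 ((D.linkable_image_iff hφ _).2 ⟨_, hp.reroute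
      (fun a ha b hb => hq.2 a (hY ha) b (hY hb)) (fun a ha => hS a (hY ha)) hd⟩)
  by_cases hgood : ∃ z ∈ Z, ∃ x ∈ S z, T.Adj z x ∧ T.dist r x = T.dist r z + 1
  · obtain ⟨z, hz, x, hx, hadj, hdist⟩ := hgood
    have hSz : S z = {x} := (hS z hz).subsingleton.eq_singleton_of_mem hx
    have hl := hp.reroute (Z := {z}) (q := q) (q' := q') (S := S)
      (fun a ha b hb => hq.2 a (ha ▸ hz) b (hb ▸ hz)) (fun a ha => ha ▸ hS z hz)
      (fun a ha b hb hab => (hab (ha.trans hb.symm)).elim)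
    have hzo := hz.2
    have hzevs : z ∉ s.evs := fun h => by
      have := s.dist_evs z h
      omega
    have hxods : x ∉ s.ods := fun h => by
      have := s.dist_ods x h
      omega
    have hxodd := (even_dist_iff_of_adj (r := r) hT hadj).1 (hZe z hz)
    refine ⟨⟨insert z s.evs, insert x s.ods, z, x,
      fun v => if v ∈ ({z} : Set V) then q' v else s.p v, hZe z hz, hadj, hdist, ?_, ?_, ?_, ?_, ?_⟩,
      hz.1, hz.2, by simp, by simp, ?_⟩
    · intro y hy
      rcases Finset.mem_insert.1 hy with rfl | hy
      exacts [hZe _ hz, s.even_of_mem y hy]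
    · intro y hy
      rcases Finset.mem_insert.1 hy with rfl | hy
      · omega
      · have := s.dist_evs y hy
        omega
    · intro y hy
      rcases Finset.mem_insert.1 hy with rfl | hy
      · omega
      · have := s.dist_ods y hy
        omega
    · rw [Finset.card_insert_of_notMem hzevs, Finset.card_insert_of_notMem hxods, s.card_eq]
    · convert hl using 1
      ext y
      have : y ∈ s.evs → y ≠ x := by
        rintro hy rfl
        exact hxodd (s.even_of_mem y hy)
      simp only [Finset.coe_insert, hB, Finset.mem_insert, not_or, hSz, mem_singleton_iff,
        iUnion_iUnion_eq_left, mem_union, mem_insert_iff, Finset.mem_coe, mem_sdiff, mem_ofPred_eq]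
      tauto
    · intro y hy
      simp only [mem_singleton_iff] at hy ⊢
      exact if_neg hy
  · exfalso
    push Not at hgood
    have hlow : ∀ z ∈ Z, ∃ x ∈ S z, T.dist r x ≤ T.dist r s.o := by
      intro z hz
      by_contra! hhigh
      obtain ⟨g, hginj, hg⟩ := hM.exists_injOn_of_dual_indep (hindep {z} (by simpa using hz)
        fun a ha b hb hab => (hab (ha.trans hb.symm)).elim)
      have hzevs : z ∉ s.evs := fun h => by
        have h1 := s.dist_evs z h
        have h2 := hz.2
        omega
      simp only [mem_singleton_iff, iUnion_iUnion_eq_left] at hginj hg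
      have hmem : ∀ y ∈ insert z s.evs, y ∈ {z} ∪ B \ S z ∧ Even (T.dist r y) := by
        intro y hy
        rcases Finset.mem_insert.1 hy with rfl | hy
        · exact ⟨.inl rfl, hZe _ hz⟩
        · refine ⟨.inr ⟨.inl hy, fun h => ?_⟩, s.even_of_mem y hy⟩
          have h1 := s.dist_evs y hy
          have h2 := hhigh y h
          omega
      have hmaps : ∀ y ∈ insert z s.evs, g y ∈ s.ods := by
        intro y hy
        obtain ⟨h1, h2⟩ := hmem y hy
        obtain ⟨hadj, hgy⟩ := hg y h1 h2
        have hodd := (even_dist_iff_of_adj (r := r) hT hadj).1 h2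
        by_contra hgo
        have hgS : g y ∈ S z := by
          by_contra h
          exact hgy (.inr ⟨.inr ⟨hodd, hgo⟩, h⟩)
        have h3 := hhigh _ hgS
        have h4 := hT.dist_eq_dist_add_one_of_adj r hadj
        have h5 := hz.2
        rcases Finset.mem_insert.1 hy with rfl | hy
        · have h6 := hgood y hz _ hgS hadj
          omega
        · have h6 := s.dist_evs y hy
          have h7 : T.dist r y ≠ T.dist r s.o := fun h => ho (h ▸ h2)
          omega
      have hcard := Finset.card_le_card_of_injOn g hmaps
        (hginj.mono fun y hy => hmem y (Finset.mem_coe.1 hy))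
      rw [Finset.card_insert_of_notMem hzevs, s.card_eq] at hcard
      omega
    choose! x hxS hxlow using hlow
    have hSx : ∀ z ∈ Z, S z = {x z} := fun z hz =>
      (hS z hz).subsingleton.eq_singleton_of_mem (hxS z hz)
    obtain ⟨z, hz, z', hz', hne⟩ : ∃ z ∈ Z, ∃ z' ∈ Z, x z ≠ x z' := by
      by_contra! hconst
      obtain ⟨z₀, hz₀⟩ := (hinf s.o).nonempty
      have : Nonempty W := ⟨φ z₀⟩
      have hmeet : ∀ z ∈ Z, ∃ w ∈ q z, w ∈ s.p (x z₀) := fun z hz => by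
        rw [← hconst z hz z₀ hz₀]
        exact (hS z hz).meets _ (hxS z hz)
      choose! w hwq hwp using hmeet
      refine hinf s.o (Finite.of_injOn (t := {y | y ∈ s.p (x z₀)}) (f := w) hwp ?_
        (List.finite_toSet _))
      intro a ha b hb hab
      by_contra h
      exact hq.2 a ha b hb h (hwq a ha) (hab ▸ hwq b hb)
    have hzz : z ≠ z' := by
      rintro rfl
      exact hne rfl
    obtain ⟨g, hginj, hg⟩ := hM.exists_injOn_of_dual_indep (hindep {z, z'} (by
      rintro y (rfl | rfl) <;> assumption) (by
      rintro a (rfl | rfl) b (rfl | rfl) hab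
      · exact (hab rfl).elim
      · simpa [hSx _ hz, hSx _ hz'] using hne
      · simpa [hSx _ hz, hSx _ hz'] using hne.symm
      · exact (hab rfl).elim))
    have hgo : ∀ y, y = z ∨ y = z' → y ∈ Z → g y = s.o := by
      intro y hy hyZ
      obtain ⟨hadj, hgy⟩ := hg y (.inl hy) (hZe y hyZ)
      have hodd := (even_dist_iff_of_adj (r := r) hT hadj).1 (hZe y hyZ)
      have hle : T.dist r (g y) ≤ T.dist r s.o := by
        by_cases h : g y ∈ s.ods
        · exact s.dist_ods _ h
        · have : g y ∈ S z ∨ g y ∈ S z' := by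
            by_contra! h'
            refine hgy (.inr ⟨.inr ⟨hodd, h⟩, ?_⟩)
            simpa using h'
          rw [hSx z hz, hSx z' hz'] at this
          rcases this with h | h <;> rw [mem_singleton_iff.1 h]
          exacts [hxlow z hz, hxlow z' hz']
      have h1 := hT.dist_eq_dist_add_one_of_adj r hadj
      have h2 := hyZ.2
      exact hT.eq_of_adj_of_dist hadj hyZ.1.symm (by omega) h2
    refine hzz (hginj ⟨.inl (.inl rfl), hZe z hz⟩ ⟨.inl (.inr rfl), hZe z' hz'⟩ ?_)
    rw [hgo z (.inl rfl) hz, hgo z' (.inr rfl) hz']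

/-- In a dimaze representing the dual, all stages of the ray construction agree with a single linkage
in the limit, so that the odd vertices of the tree, with those of a ray exchanged for the even ones,
would be linkable. But this set is dependent in the dual. -/
theorem not_isGammoid_dual (hM : (alternatingTreeDimaze T hT r).Defines M)
    (hinf : ∀ v : V, {w : V | T.Adj v w ∧ T.dist r w = T.dist r v + 1}.Infinite) :
    ¬ Matroid.IsGammoid.{u, v} M✶ := by
  classical
  intro hgam
  obtain ⟨W, D, φ, hφ, hD⟩ := hgam.exists_dimaze (by simp [hM.1])
  obtain ⟨s₀, hs₀e, hs₀o⟩ := exists_rayStage hM hinf hφ hD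
  choose next hadj hdist hevs hods hp using RayStage.exists_next hM hinf hφ hD
  let s : ℕ → RayStage T r D φ := fun n => next^[n] s₀
  have hs : ∀ n, s (n + 1) = next (s n) := fun n => Function.iterate_succ_apply' next n s₀
  have hmem_evs : ∀ n i, i ≤ n → (s i).e ∈ (s n).evs := by
    intro n
    induction n with
    | zero =>
      intro i hi
      obtain rfl : i = 0 := by omega
      simp [s, hs₀e]
    | succ n ih =>
      intro i hi
      rw [hs n, hevs]
      rcases Nat.lt_or_ge n i with h | h
      · obtain rfl : i = n + 1 := by omega
        exact .inl (by rw [hs n])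
      · exact .inr (ih i h)
  have hmem_ods : ∀ n x, x ∈ (s n).ods → ∃ i, x = (s i).o := by
    intro n
    induction n with
    | zero =>
      intro x hx
      exact ⟨0, by simpa [s, hs₀o] using hx⟩
    | succ n ih =>
      intro x hx
      rw [hs n, hods, ← hs n] at hx
      rcases hx with rfl | hx
      exacts [⟨_, rfl⟩, ih x hx]
  have hstep : ∀ i, T.Adj (s i).o (s (i + 1)).e ∧
      T.dist r (s (i + 1)).e = T.dist r (s i).o + 1 := by
    intro i
    rw [hs i]
    exact ⟨hadj _, hdist _⟩
  let A : Set V := {x | (∃ i, x = (s i).e) ∨ ¬ Even (T.dist r x) ∧ ∀ i, x ≠ (s i).o}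
  refine hM.not_dual_indep_of_ray (e := fun i => (s i).e) (o := fun i => (s i).o) (A := A)
    (fun i => (s i).e_even) (fun i => (s i).dist_o) hstep (fun i => .inl ⟨i, rfl⟩)
    (fun i x hx hxo => .inr ⟨(even_dist_iff_of_adj hT hx).1 (s i).e_even, hxo⟩) ?_
  -- The path of each element of `A` is eventually constant, and so the linkages converge.
  have hlim : ∀ x, ∃ l : List W, x ∈ A → ∃ n, ∀ k, n ≤ k →
      x ∈ (↑(s k).evs ∪ {x | ¬ Even (T.dist r x) ∧ x ∉ (s k).ods} : Set V) ∧ (s k).p x = l := by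
    intro x
    by_cases hx : x ∈ A
    · rcases hx with ⟨i, rfl⟩ | ⟨hxodd, hxo⟩
      · refine ⟨(s i).p (s i).e, fun _ => ⟨i, fun k hk => ⟨.inl (hmem_evs k i hk), ?_⟩⟩⟩
        induction k, hk using Nat.le_induction with
        | base => rfl
        | succ k hk ih =>
          rw [← ih, hs k]
          refine hp _ _ fun h => ?_
          have h1 := (s k).dist_evs _ (hmem_evs k i hk)
          have h2 := hdist (s k)
          rw [← h] at h2
          omega
      · refine ⟨s₀.p x, fun _ => ⟨0, fun k hk => ⟨.inr ⟨hxodd, fun h => ?_⟩, ?_⟩⟩⟩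
        · obtain ⟨i, hi⟩ := hmem_ods k x h
          exact hxo i hi
        · induction k, hk using Nat.le_induction with
          | base => rfl
          | succ k hk ih =>
            rw [← ih, hs k]
            refine hp _ _ fun h => hxodd ?_
            rw [h]
            exact (next (s k)).e_even
    · exact ⟨[], fun h => (hx h).elim⟩
  choose p hp' using hlim
  refine (hD _).2 ((D.linkable_image_iff hφ _).2 ⟨p, fun x hx => ?_, fun x hx y hy hxy => ?_⟩)
  · obtain ⟨n, hn⟩ := hp' x hx
    obtain ⟨h1, h2⟩ := hn n le_rfl
    rw [← h2]
    exact (s n).linked.1 x h1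
  · obtain ⟨n, hn⟩ := hp' x hx
    obtain ⟨k, hk⟩ := hp' y hy
    obtain ⟨h1, h2⟩ := hn (max n k) (le_max_left _ _)
    obtain ⟨h3, h4⟩ := hk (max n k) (le_max_right _ _)
    rw [← h2, ← h4]
    exact (s (max n k)).linked.2 x h1 y h3 hxy

end NotGammoid

/-! ### A tree with infinite branching, and the failure of duality -/

/-- The tree of finite sequences of natural numbers: `n :: l` is a child of `l`. -/
def sequenceTree : SimpleGraph (ULift.{v} (List ℕ)) where
  Adj x y := (∃ n, x.down = n :: y.down) ∨ ∃ n, y.down = n :: x.down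
  symm := ⟨fun _ _ h => h.symm⟩
  loopless := ⟨fun x h => by
    rcases h with ⟨n, h⟩ | ⟨n, h⟩ <;> exact List.cons_ne_self n _ h.symm⟩

lemma sequenceTree_exists_walk (l : List ℕ) :
    ∃ p : sequenceTree.{v}.Walk ⟨[]⟩ ⟨l⟩, p.length = l.length := by
  induction l with
  | nil => exact ⟨.nil, rfl⟩
  | cons n l ih =>
    obtain ⟨p, hp⟩ := ih
    have h : sequenceTree.{v}.Adj ⟨l⟩ ⟨n :: l⟩ := .inr ⟨n, rfl⟩
    exact ⟨p.concat h, by simp [hp]⟩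

lemma sequenceTree_length_le {x y : ULift.{v} (List ℕ)} (p : sequenceTree.Walk x y) :
    y.down.length ≤ x.down.length + p.length := by
  induction p with
  | nil => simp
  | @cons a b c h p ih =>
    rw [SimpleGraph.Walk.length_cons]
    rcases h with ⟨n, h⟩ | ⟨n, h⟩ <;> have := congrArg List.length h <;>
      simp only [List.length_cons] at this <;> omega

lemma sequenceTree_dist (x : ULift.{v} (List ℕ)) :
    sequenceTree.dist ⟨[]⟩ x = x.down.length := by
  obtain ⟨l⟩ := x
  obtain ⟨p, hp⟩ := sequenceTree_exists_walk.{v} l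
  obtain ⟨q, hq⟩ := p.reachable.exists_walk_length_eq_dist
  have h1 : l.length ≤ 0 + q.length := sequenceTree_length_le q
  have h2 := SimpleGraph.dist_le p
  change _ = l.length
  omega

lemma sequenceTree_isTree : sequenceTree.{v}.IsTree := by
  have hroot : ∀ x, sequenceTree.{v}.Reachable ⟨[]⟩ x := fun x =>
    (sequenceTree_exists_walk x.down).choose.reachable
  have : Nonempty (ULift.{v} (List ℕ)) := ⟨⟨[]⟩⟩
  refine ⟨⟨fun x y => (hroot x).symm.trans (hroot y)⟩, ?_⟩
  rw [SimpleGraph.isAcyclic_iff_forall_adj_isBridge]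
  -- Without the edge from `n :: l` to `l`, the sequences extending `n :: l` are cut off.
  have key : ∀ x y : ULift.{v} (List ℕ), (∃ n, x.down = n :: y.down) →
      sequenceTree.IsBridge s(x, y) := by
    rintro x y ⟨n, hn⟩
    rw [SimpleGraph.isBridge_iff]
    rintro ⟨p⟩
    have hinv : ∀ a b, (sequenceTree.deleteEdges {s(x, y)}).Walk a b → x.down <:+ a.down →
        x.down <:+ b.down := by
      intro a b p
      induction p with
      | nil => exact id
      | @cons a b c h p ih =>
        intro ha
        refine ih ?_
        rw [SimpleGraph.deleteEdges_adj] at h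
        obtain ⟨⟨k, hk⟩ | ⟨k, hk⟩, hne⟩ := h
        · rw [hk] at ha
          rcases List.suffix_cons_iff.1 ha with h | h
          · refine (hne ?_).elim
            have hax : x = a := ULift.ext _ _ (h.trans hk.symm)
            have hby : y = b := ULift.ext _ _ (List.cons.inj (hn.symm.trans h)).2
            rw [hax, hby]
            rfl
          · exact h
        · rw [hk]
          exact ha.trans (List.suffix_cons _ _)
    have hsuf := (hinv _ _ p List.suffix_rfl).length_le
    rw [hn, List.length_cons] at hsuf
    omega
  intro x y h
  rcases h with h | h
  · exact key x y h
  · rw [Sym2.eq_swap]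
    exact key y x h

lemma sequenceTree_infinite (x : ULift.{v} (List ℕ)) :
    {w | sequenceTree.Adj x w ∧
      sequenceTree.dist ⟨[]⟩ w = sequenceTree.dist ⟨[]⟩ x + 1}.Infinite := by
  refine infinite_of_injective_forall_mem
    (f := fun n : ℕ => (⟨n :: x.down⟩ : ULift (List ℕ))) ?_ ?_
  · intro a b h
    exact (List.cons.inj (congrArg ULift.down h)).1
  · intro n
    exact ⟨.inr ⟨n, rfl⟩, by simp [sequenceTree_dist]⟩

namespace Matroid

lemma Isomorphic.refl {α : Type u} (M : Matroid α) : M.Isomorphic M :=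
  ⟨Equiv.refl _, fun I => by simp⟩

lemma Isomorphic.trans {α : Type*} {β : Type*} {γ : Type*} {M : Matroid α} {N : Matroid β}
    {P : Matroid γ} (h : M.Isomorphic N) (h' : N.Isomorphic P) : M.Isomorphic P := by
  obtain ⟨e, he⟩ := h
  obtain ⟨e', he'⟩ := h'
  refine ⟨e.trans e', fun I => ?_⟩
  rw [he, he', image_image, image_image, image_image]
  rfl

/-- A bijection between the underlying types that preserves independence is an isomorphism, if the
ground sets are everything. -/
lemma Isomorphic.of_equiv {α : Type*} {β : Type*} {M : Matroid α} {N : Matroid β} (hM : M.E = univ)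
    (hN : N.E = univ) (f : α ≃ β) (h : ∀ I, M.Indep I ↔ N.Indep (f '' I)) : M.Isomorphic N := by
  have hM' : ∀ x, x ∈ M.E := by simp [hM]
  have hN' : ∀ x, x ∈ N.E := by simp [hN]
  refine ⟨⟨fun x => ⟨f x, hN' _⟩, fun y => ⟨f.symm y, hM' _⟩, fun x => by simp, fun y => by simp⟩,
    fun I => ?_⟩
  rw [h, image_image, image_image]
  rfl

lemma IsGammoid.of_isomorphic {α : Type*} {β : Type*} {M : Matroid α} {N : Matroid β}
    (h : M.Isomorphic N) (hN : IsGammoid.{_, v} N) : IsGammoid.{_, v} M := by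
  obtain ⟨γ, P, X, hP, hX, hNP⟩ := hN
  exact ⟨γ, P, X, hP, hX, h.trans hNP⟩

end Matroid

lemma Dimaze.Defines.isGammoid {W : Type v} {D : Dimaze W} {M : Matroid W} (h : D.Defines M) :
    Matroid.IsGammoid.{v, v} M :=
  ⟨W, M, M.E, ⟨W, D, M, h, .refl M⟩, Subset.rfl, by
    rw [Matroid.restrict_ground_eq_self]
    exact .refl M⟩

theorem mainTheorem7 :
    (∀ (V : Type u) (T : SimpleGraph V) (hT : T.IsTree) (r : V),
      (∀ v : V, {w : V | T.Adj v w ∧ T.dist r w = T.dist r v + 1}.Infinite) →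
      ∃ M : Matroid V, (alternatingTreeDimaze T hT r).Defines M ∧
        ¬ Matroid.IsGammoid.{u, v} M✶) ∧
    ¬ (∀ (α : Type u) (M : Matroid α),
      Matroid.IsGammoid.{u, v} M → Matroid.IsGammoid.{u, v} M✶) := by
  refine ⟨fun V T hT r hinf => ?_, fun hdual => ?_⟩
  · obtain ⟨M, hM⟩ := exists_defines hT r
    exact ⟨M, hM, not_isGammoid_dual hM hinf⟩
  · -- The matroid of the tree lives in the universe of the dimazes; transport it to `Type u`.
    obtain ⟨M, hM⟩ := exists_defines sequenceTree_isTree.{v} ⟨[]⟩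
    have hME : M.E = univ := hM.1
    let f : ULift.{v} (List ℕ) ≃ ULift.{u} (List ℕ) := Equiv.ulift.trans Equiv.ulift.symm
    let N : Matroid (ULift.{u} (List ℕ)) := M.mapEquiv f
    have hNE : N.E = univ := by simp [N, hME]
    have hN : Matroid.IsGammoid.{u, v} N := by
      refine .of_isomorphic (.of_equiv hNE hME f.symm fun I => ?_) hM.isGammoid
      exact Matroid.mapEquiv_indep_iff
    refine not_isGammoid_dual hM sequenceTree_infinite
      (.of_isomorphic (.of_equiv ?_ ?_ f fun I => ?_) (hdual _ N hN))
    · simpa using hME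
    · simpa using hNE
    · rw [Matroid.dual_indep_iff_exists (by simp [hME]),
        Matroid.dual_indep_iff_exists (by simp [hNE])]
      constructor
      · rintro ⟨B, hB, hIB⟩
        refine ⟨f '' B, ?_, (disjoint_image_iff f.injective).2 hIB⟩
        rw [Matroid.mapEquiv_isBase_iff, Equiv.symm_image_image]
        exact hB
      · rintro ⟨B, hB, hIB⟩
        refine ⟨f.symm '' B, Matroid.mapEquiv_isBase_iff.1 hB, ?_⟩
        rw [← disjoint_image_iff f.injective, Equiv.image_symm_image]
        exact hIB
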